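/- For an integer $n\ge 7$, let $P(n,3)$ be the generalized Petersen graph with vertex set $\{u_1,\dots,u_n,v_1,\dots,v_n\}$ and edges $u_iu_{i+1}$, $u_iv_i$ and $v_iv_{i+3}$ for $1\le i\le n$, subscripts being taken modulo $n$. For a finite connected graph $G$ with distance $d$, a set $W\subseteq V(G)$ is a resolving set if for all $x,y\in V(G)$, $d(x,w)=d(y,w)$ for every $w\in W$ implies $x=y$; the metric dimension $\dim(G)$ is the minimum cardinality of a resolving set of $G$. For every integer $n\ge 36$ with $n\equiv 2,3,4$ or $5\pmod 6$, $$\dim(P(n,3))=4.$$ -/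

import Mathlib

/-- A finite set `W` of vertices of a connected graph `G` is a resolving set if any two vertices with
the same distances to all members of `W` (the same metric representation) are equal. -/
def SimpleGraph.IsResolvingSet {V : Type*} (G : SimpleGraph V) (W : Finset V) : Prop :=
  ∀ x y : V, (∀ w ∈ W, G.dist x w = G.dist y w) → x = y

/-- The metric dimension of a finite connected graph: the minimum cardinality of a resolving set. -/
noncomputable def SimpleGraph.metricDim {V : Type*} (G : SimpleGraph V) : ℕ :=
  sInf {k : ℕ | ∃ W : Finset V, G.IsResolvingSet W ∧ W.card = k}

/-- The generalized Petersen graph `P(n, m)` (for `n ≥ 3` and `1 ≤ m ≤ (n - 1) / 2`). The vertex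
`Sum.inl i` is the outer vertex `u_i` and `Sum.inr i` is the inner vertex `v_i`, with subscripts
modulo `n`; the edges are `u_i u_{i+1}`, `u_i v_i` and `v_i v_{i+m}`. -/
def generalizedPetersen (n m : ℕ) : SimpleGraph (ZMod n ⊕ ZMod n) :=
  SimpleGraph.fromEdgeSet {e | ∃ i : ZMod n,
    e = s(Sum.inl i, Sum.inl (i + 1)) ∨
    e = s(Sum.inl i, Sum.inr i) ∨
    e = s(Sum.inr i, Sum.inr (i + (m : ZMod n)))}

/-! On the infinite analogue of the graph, with outer path `ℤ` and inner steps of 3, an offset `a`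
costs about `a / 3` plus a term depending on `a % 3`; on the cycle the distance is the smaller of
the values for the two arcs. Walks give the upper bound, a 1-Lipschitz potential the lower one
(`dist_vtx`).

Both halves of the theorem then go by induction from `n` to `n + 6`. Insert three positions at each
of two roughly antipodal cuts. A landmark and a vertex on the same side of the cuts, with enough
margin, keep their distance; on opposite sides both arcs grow by 3 and the distance grows by exactly
1 (`ringDist_add_six_near`, `ringDist_add_six_far`). Hence equalities of distances to one landmark
are preserved.

Lower bound: any three landmarks leave unresolved some pair of one of eight shapes (`allConfuse`).
This is computed for `n < 102`; for larger `n` a union bound over rotations finds cuts far from all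
three landmarks (`exists_cut`), and an unresolved pair on the shorter cycle is carried to the longer
one.

Upper bound: one of two explicit families of four landmarks separates all vertices (`separates`).
This is computed for `n < 66`; beyond that, two vertices with equal distances are either both away
from the antipode of 0 or both away from 0, and can be transferred together to the shorter cycle. -/

namespace GenPetersenThree

/-! ### Distance formulas on the line and on the cycle -/

/-- Distance in the infinite graph with outer path `ℤ` and inner steps `3`, between vertices at
offset `a`; `false` marks outer vertices and `true` inner ones. -/
def lineDist (s t : Bool) (a : ℕ) : ℕ :=
  match s, t with
  | false, false => cond (Nat.ble a 3) a (Nat.add (Nat.add (Nat.div a 3) (Nat.mod a 3)) 2)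
  | true, true => cond (Nat.beq (Nat.mod a 3) 0) (Nat.div a 3)
      (Nat.add (Nat.add (Nat.div a 3) (Nat.mod a 3)) 2)
  | _, _ => Nat.add (Nat.add (Nat.div a 3) (Nat.mod a 3)) 1

theorem lineDist_false_false (a : ℕ) :
    lineDist false false a = if a ≤ 3 then a else a / 3 + a % 3 + 2 := by
  show cond (Nat.ble a 3) a (a / 3 + a % 3 + 2) = _
  by_cases h : a ≤ 3
  · simp [h, Nat.ble_eq_true_of_le h]
  · have : Nat.ble a 3 = false := by
      rw [← Bool.not_eq_true, Nat.ble_eq]; exact h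
    simp [h, this]

theorem lineDist_true_true (a : ℕ) :
    lineDist true true a = if a % 3 = 0 then a / 3 else a / 3 + a % 3 + 2 := by
  show cond (Nat.beq (a % 3) 0) (a / 3) (a / 3 + a % 3 + 2) = _
  by_cases h : a % 3 = 0
  · simp [h]
  · have : Nat.beq (a % 3) 0 = false := by
      rw [← Bool.not_eq_true, Nat.beq_eq]; exact h
    simp [h, this]

theorem lineDist_false_true (a : ℕ) : lineDist false true a = a / 3 + a % 3 + 1 := rfl

theorem lineDist_true_false (a : ℕ) : lineDist true false a = a / 3 + a % 3 + 1 := rfl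

/-- Distance in the cyclic graph of length `n` between vertices at offset `k`. -/
def cycDist (n : ℕ) (s t : Bool) (k : ℕ) : ℕ :=
  cond (Nat.ble (lineDist s t (Nat.mod k n)) (lineDist s t (Nat.sub n (Nat.mod k n))))
    (lineDist s t (Nat.mod k n)) (lineDist s t (Nat.sub n (Nat.mod k n)))

theorem cycDist_eq (n : ℕ) (s t : Bool) (k : ℕ) :
    cycDist n s t k = min (lineDist s t (k % n)) (lineDist s t (n - k % n)) := by
  show cond (Nat.ble (lineDist s t (k % n)) (lineDist s t (n - k % n)))
    (lineDist s t (k % n)) (lineDist s t (n - k % n)) = _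
  by_cases h : lineDist s t (k % n) ≤ lineDist s t (n - k % n)
  · rw [Nat.ble_eq_true_of_le h, min_eq_left h]; rfl
  · have : Nat.ble (lineDist s t (k % n)) (lineDist s t (n - k % n)) = false := by
      rw [← Bool.not_eq_true, Nat.ble_eq]; exact h
    rw [this, min_eq_right (by omega)]; rfl

theorem cycDist_of_le {n k : ℕ} (s t : Bool) (h : k ≤ n) :
    cycDist n s t k = min (lineDist s t k) (lineDist s t (n - k)) := by
  rw [cycDist_eq]
  rcases h.lt_or_eq with h | rfl
  · rw [Nat.mod_eq_of_lt h]
  · simp [min_comm]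

/-- `cycDist` with an integer offset. -/
def ringDist (n : ℕ) (s t : Bool) (k : ℤ) : ℕ := cycDist n s t (k % n).toNat

theorem ringDist_congr {n : ℕ} (s t : Bool) {k l : ℤ} (h : k ≡ l [ZMOD n]) :
    ringDist n s t k = ringDist n s t l := by
  unfold ringDist; rw [h.eq]

theorem ringDist_add (n : ℕ) (s t : Bool) (k : ℤ) :
    ringDist n s t (k + n) = ringDist n s t k :=
  ringDist_congr s t (by simp [Int.ModEq])

theorem ringDist_natCast (n : ℕ) (s t : Bool) (k : ℕ) :
    ringDist n s t (k : ℤ) = cycDist n s t k := by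
  have h : ((k : ℤ) % n).toNat = k % n := by
    rw [← Int.natCast_emod, Int.toNat_natCast]
  rw [ringDist, h, cycDist_eq, cycDist_eq, Nat.mod_mod]

theorem ringDist_of_mem {n : ℕ} (s t : Bool) {k : ℤ} (h0 : 0 ≤ k) (h : k ≤ n) :
    ringDist n s t k = min (lineDist s t k.toNat) (lineDist s t (n - k.toNat)) := by
  lift k to ℕ using h0
  rw [ringDist_natCast, cycDist_of_le s t (by omega), Int.toNat_natCast]

theorem ringDist_of_neg_mem {n : ℕ} (s t : Bool) {k : ℤ} (h0 : k ≤ 0) (h : -k ≤ n) :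
    ringDist n s t k = min (lineDist s t k.natAbs) (lineDist s t (n - k.natAbs)) := by
  rw [← ringDist_add, ringDist_of_mem s t (by omega) (by omega), min_comm]
  congr 2 <;> omega

theorem ringDist_of_natAbs_le {n : ℕ} (s t : Bool) {k : ℤ} (h : k.natAbs ≤ n) :
    ringDist n s t k = min (lineDist s t k.natAbs) (lineDist s t (n - k.natAbs)) := by
  rcases le_total 0 k with h0 | h0
  · rw [ringDist_of_mem s t h0 (by omega)]
    congr 2 <;> omega
  · exact ringDist_of_neg_mem s t h0 (by omega)

/-- The formulas are not monotone, but the dips come only from the residue modulo 3; a gap of 10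
absorbs them. -/
theorem lineDist_le_lineDist {a b : ℕ} (s t : Bool) (h : a + 10 ≤ b) :
    lineDist s t a ≤ lineDist s t b := by
  cases s <;> cases t <;>
    simp only [lineDist_false_false, lineDist_true_true, lineDist_false_true,
      lineDist_true_false] <;> (try split_ifs) <;> omega

theorem lineDist_add_three {a : ℕ} (s t : Bool) (h : 3 ≤ a) :
    lineDist s t (a + 3) = lineDist s t a + 1 := by
  cases s <;> cases t <;>
    simp only [lineDist_false_false, lineDist_true_true, lineDist_false_true,
      lineDist_true_false] <;> (try split_ifs) <;> omega

theorem ringDist_eq_lineDist {n : ℕ} (s t : Bool) {k : ℤ} (h : 2 * k.natAbs + 10 ≤ n) :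
    ringDist n s t k = lineDist s t k.natAbs := by
  rw [ringDist_of_natAbs_le s t (by omega), min_eq_left]
  exact lineDist_le_lineDist s t (by omega)

/-- A short arc is optimal on both cycles, and its length does not change. The alternatives for `l`
are representatives of one class modulo `n + 6`. -/
theorem ringDist_add_six_near {n : ℕ} (s t : Bool) {k l : ℤ} (h : 2 * k.natAbs + 10 ≤ n)
    (hl : l = k ∨ l = k + (n + 6) ∨ l = k - (n + 6)) :
    ringDist (n + 6) s t l = ringDist n s t k := by
  rw [ringDist_eq_lineDist s t h, ← ringDist_eq_lineDist (n := n + 6) s t (by omega)]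
  apply ringDist_congr
  rcases hl with rfl | rfl | rfl
  · rfl
  · simp [Int.ModEq]
  · simp [Int.ModEq]

/-- Both arcs gain one inner step, so their minimum does too. The bound 3 avoids the range where the
outer path beats the spokes. -/
theorem ringDist_add_six_far {n : ℕ} (s t : Bool) {k l : ℤ} (h : 3 ≤ k) (h' : k + 3 ≤ n)
    (hl : l = k + 3 ∨ l = k - n - 3) :
    ringDist (n + 6) s t l = ringDist n s t k + 1 := by
  have key : ringDist (n + 6) s t (k + 3) = ringDist n s t k + 1 := by
    lift k to ℕ using (by omega)
    rw [ringDist_of_mem s t (by omega) (by omega), ringDist_of_mem s t (by omega) (by omega),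
      show ((k : ℤ) + 3).toNat = k + 3 by omega, Int.toNat_natCast,
      show n + 6 - (k + 3) = (n - k) + 3 by omega, lineDist_add_three s t (by omega),
      lineDist_add_three s t (by omega)]
    omega
  rw [← key]
  apply ringDist_congr
  rcases hl with rfl | rfl
  · rfl
  · rw [show k + 3 = k - n - 3 + ((n + 6 : ℕ) : ℤ) by push_cast; ring]
    simp [Int.ModEq]

/-! ### The formula is the graph distance -/

/-- The vertex `u_k` (for `false`) or `v_k` (for `true`). -/
def vtx (n : ℕ) (t : Bool) (k : ℤ) : ZMod n ⊕ ZMod n :=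
  if t then Sum.inr (k : ZMod n) else Sum.inl (k : ZMod n)

theorem exists_vtx {n : ℕ} (v : ZMod n ⊕ ZMod n) : ∃ t k, v = vtx n t k := by
  rcases v with x | x
  · obtain ⟨k, rfl⟩ := ZMod.intCast_surjective x
    exact ⟨false, k, rfl⟩
  · obtain ⟨k, rfl⟩ := ZMod.intCast_surjective x
    exact ⟨true, k, rfl⟩

theorem vtx_congr {n : ℕ} (t : Bool) {k l : ℤ} (h : k ≡ l [ZMOD n]) : vtx n t k = vtx n t l := by
  have : (k : ZMod n) = l := (ZMod.intCast_eq_intCast_iff k l n).2 h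
  simp [vtx, this]

theorem intCast_ne_add {n : ℕ} (k : ℤ) {m : ℕ} (h0 : 0 < m) (h : m < n) :
    (k : ZMod n) ≠ (k : ZMod n) + (m : ZMod n) := by
  intro e
  have : ((m : ℕ) : ZMod n) = 0 := by simpa using e.symm
  rw [ZMod.natCast_eq_zero_iff] at this
  exact absurd (Nat.le_of_dvd h0 this) (by omega)

theorem adj_outer {n : ℕ} (h : 4 ≤ n) (k : ℤ) :
    (generalizedPetersen n 3).Adj (vtx n false k) (vtx n false (k + 1)) := by
  rw [generalizedPetersen, SimpleGraph.fromEdgeSet_adj]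
  refine ⟨⟨k, Or.inl ?_⟩, ?_⟩
  · simp [vtx]
  · have := intCast_ne_add (n := n) k (m := 1) (by omega) (by omega)
    simpa [vtx] using this

theorem adj_spoke {n : ℕ} (k : ℤ) :
    (generalizedPetersen n 3).Adj (vtx n false k) (vtx n true k) := by
  rw [generalizedPetersen, SimpleGraph.fromEdgeSet_adj]
  refine ⟨⟨k, Or.inr (Or.inl ?_)⟩, ?_⟩
  · simp [vtx]
  · simp [vtx]

theorem adj_inner {n : ℕ} (h : 4 ≤ n) (k : ℤ) :
    (generalizedPetersen n 3).Adj (vtx n true k) (vtx n true (k + 3)) := by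
  rw [generalizedPetersen, SimpleGraph.fromEdgeSet_adj]
  refine ⟨⟨k, Or.inr (Or.inr ?_)⟩, ?_⟩
  · simp [vtx]
  · have := intCast_ne_add (n := n) k (m := 3) (by omega) (by omega)
    simpa [vtx] using this

/-- There is a walk of length at most `m` from `a` to `b`. -/
def Within (n m : ℕ) (a b : ZMod n ⊕ ZMod n) : Prop :=
  ∃ p : (generalizedPetersen n 3).Walk a b, p.length ≤ m

theorem Within.refl {n : ℕ} (a : ZMod n ⊕ ZMod n) : Within n 0 a a := ⟨.nil, le_rfl⟩

theorem Within.symm {n m : ℕ} {a b : ZMod n ⊕ ZMod n} (h : Within n m a b) : Within n m b a := by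
  obtain ⟨p, hp⟩ := h
  exact ⟨p.reverse, by simpa using hp⟩

theorem Within.trans {n l m : ℕ} {a b c : ZMod n ⊕ ZMod n} (h : Within n l a b)
    (h' : Within n m b c) : Within n (l + m) a c := by
  obtain ⟨p, hp⟩ := h
  obtain ⟨q, hq⟩ := h'
  exact ⟨p.append q, by rw [SimpleGraph.Walk.length_append]; omega⟩

theorem within_of_adj {n : ℕ} {a b : ZMod n ⊕ ZMod n} (h : (generalizedPetersen n 3).Adj a b) :
    Within n 1 a b := ⟨h.toWalk, by simp⟩

theorem Within.mono {n l m : ℕ} {a b : ZMod n ⊕ ZMod n} (h : Within n l a b) (hl : l ≤ m) :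
    Within n m a b := by
  obtain ⟨p, hp⟩ := h
  exact ⟨p, hp.trans hl⟩

theorem within_outer {n : ℕ} (h : 4 ≤ n) (k : ℤ) (m : ℕ) :
    Within n m (vtx n false k) (vtx n false (k + m)) := by
  induction m with
  | zero => simpa using Within.refl _
  | succ m ih =>
    have := ih.trans (within_of_adj (adj_outer h (k + m)))
    rwa [add_assoc, ← Nat.cast_succ] at this

theorem within_inner {n : ℕ} (h : 4 ≤ n) (k : ℤ) (m : ℕ) :
    Within n m (vtx n true k) (vtx n true (k + 3 * m)) := by
  induction m with
  | zero => simpa using Within.refl _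
  | succ m ih =>
    have := ih.trans (within_of_adj (adj_inner h (k + 3 * m)))
    rwa [show k + 3 * (m : ℤ) + 3 = k + 3 * ((m + 1 : ℕ) : ℤ) by push_cast; ring] at this

/-- The walk makes `a / 3` inner and `a % 3` outer steps, plus the spokes needed. Overshooting by an
inner step and going back never helps: for residue 2 it costs the same. -/
theorem within_lineDist {n : ℕ} (h : 4 ≤ n) (s t : Bool) (k : ℤ) (a : ℕ) :
    Within n (lineDist s t a) (vtx n s k) (vtx n t (k + a)) := by
  have hi := within_inner h k (a / 3)
  have ho := within_outer h (k + 3 * (a / 3 : ℕ)) (a % 3)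
  have hk : k + 3 * ((a / 3 : ℕ) : ℤ) + (a % 3 : ℕ) = k + a := by omega
  rw [hk] at ho
  have sp := fun k => within_of_adj (adj_spoke (n := n) k)
  have hio := (hi.trans (sp _).symm).trans ho
  cases s <;> cases t
  · rw [lineDist_false_false]
    split_ifs
    · exact within_outer h k a
    · exact ((sp k).trans hio).mono (by omega)
  · rw [lineDist_false_true]
    have ho := within_outer h k (a % 3)
    have hi := within_inner h (k + (a % 3 : ℕ)) (a / 3)
    rw [show k + ((a % 3 : ℕ) : ℤ) + 3 * (a / 3 : ℕ) = k + a by omega] at hi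
    exact ((ho.trans (sp _)).trans hi).mono (by omega)
  · rw [lineDist_true_false]
    exact hio.mono (by omega)
  · rw [lineDist_true_true]
    split_ifs with h3
    · rwa [show k + 3 * ((a / 3 : ℕ) : ℤ) = k + a by omega] at hi
    · exact (hio.trans (sp _)).mono (by omega)

theorem lineDist_comm (s t : Bool) (a : ℕ) : lineDist s t a = lineDist t s a := by
  cases s <;> cases t <;> rfl

theorem within_ringDist {n : ℕ} (h : 4 ≤ n) (s t : Bool) (w x : ℤ) :
    Within n (ringDist n s t (x - w)) (vtx n t x) (vtx n s w) := by
  have hn : (0 : ℤ) < n := by omega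
  have h0 := Int.emod_nonneg (x - w) hn.ne'
  have h1 := Int.emod_lt_of_pos (x - w) hn
  have hc : (x - w) % n ≡ x - w [ZMOD n] := Int.mod_modEq _ _
  rw [← ringDist_congr s t hc, ringDist_of_mem s t h0 h1.le]
  obtain ⟨k, hk⟩ := Int.eq_ofNat_of_zero_le h0
  rw [hk] at hc h1 ⊢
  rw [Int.toNat_natCast]
  rcases min_choice (lineDist s t k) (lineDist s t (n - k)) with e | e <;> rw [e]
  · have := (within_lineDist h s t w k).symm
    rwa [vtx_congr t (k := w + k) (l := x)] at this
    simpa using hc.add_left w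
  · rw [lineDist_comm]
    have := within_lineDist h t s x (n - k)
    rwa [vtx_congr s (k := x + (n - k : ℕ)) (l := w)] at this
    rw [Nat.cast_sub (by omega)]
    have h2 := hc.sub_left (x + n)
    rw [show x + (n : ℤ) - k = x + (n - k) by ring, show x + (n : ℤ) - (x - w) = w + n by ring] at h2
    exact h2.trans (by simp [Int.ModEq])

theorem ringDist_step_outer {n : ℕ} (h : 8 ≤ n) (s : Bool) {k : ℤ} (h0 : 0 ≤ k) (h1 : k < n) :
    ringDist n s false (k + 1) ≤ ringDist n s false k + 1 ∧
      ringDist n s false k ≤ ringDist n s false (k + 1) + 1 := by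
  rw [ringDist_of_mem s _ h0 (by omega), ringDist_of_mem s _ (by omega) (by omega)]
  lift k to ℕ using h0
  rw [show ((k : ℤ) + 1).toNat = k + 1 by omega, Int.toNat_natCast]
  cases s <;> simp only [lineDist_false_false, lineDist_true_false] <;> (try split_ifs) <;> omega

theorem ringDist_step_spoke {n : ℕ} (s : Bool) {k : ℤ} (h0 : 0 ≤ k) (h1 : k < n) :
    ringDist n s true k ≤ ringDist n s false k + 1 ∧
      ringDist n s false k ≤ ringDist n s true k + 1 := by
  rw [ringDist_of_mem s _ h0 (by omega), ringDist_of_mem s _ (by omega) (by omega)]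
  lift k to ℕ using h0
  rw [Int.toNat_natCast]
  cases s <;> simp only [lineDist_false_false, lineDist_true_false, lineDist_false_true,
    lineDist_true_true] <;> (try split_ifs) <;> omega

theorem ringDist_step_inner {n : ℕ} (h : 8 ≤ n) (s : Bool) {k : ℤ} (h0 : 0 ≤ k) (h1 : k < n) :
    ringDist n s true (k + 3) ≤ ringDist n s true k + 1 ∧
      ringDist n s true k ≤ ringDist n s true (k + 3) + 1 := by
  rcases le_or_gt (k + 3) n with h2 | h2
  · rw [ringDist_of_mem s _ h0 (by omega), ringDist_of_mem s _ (by omega) (by omega)]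
    lift k to ℕ using h0
    rw [show ((k : ℤ) + 3).toNat = k + 3 by omega, Int.toNat_natCast]
    cases s <;> simp only [lineDist_true_true, lineDist_false_true] <;>
      (try split_ifs) <;> omega
  · rw [show k + 3 = (k + 3 - n) + n by ring, ringDist_add,
      ringDist_of_mem s _ h0 (by omega), ringDist_of_mem s _ (by omega) (by omega)]
    lift k to ℕ using h0
    rw [show ((k : ℤ) + 3 - n).toNat = k + 3 - n by omega, Int.toNat_natCast]
    cases s <;> simp only [lineDist_true_true, lineDist_false_true] <;>
      (try split_ifs) <;> omega

/-- The claimed distance to `vtx n s w`, as a function on vertices. -/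
def potential (n : ℕ) (s : Bool) (w : ℤ) : ZMod n ⊕ ZMod n → ℕ
  | Sum.inl x => ringDist n s false ((x - w : ZMod n).val : ℤ)
  | Sum.inr x => ringDist n s true ((x - w : ZMod n).val : ℤ)

theorem ringDist_val {n : ℕ} (h : 0 < n) (s t : Bool) (x w : ℤ) :
    ringDist n s t (((x : ZMod n) - (w : ZMod n)).val : ℤ) = ringDist n s t (x - w) := by
  have : NeZero n := ⟨h.ne'⟩
  apply ringDist_congr
  rw [← Int.cast_sub, ZMod.val_intCast]
  exact Int.mod_modEq _ _

theorem potential_vtx {n : ℕ} (h : 0 < n) (s t : Bool) (w x : ℤ) :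
    potential n s w (vtx n t x) = ringDist n s t (x - w) := by
  cases t <;> exact ringDist_val h s _ x w

theorem potential_adj {n : ℕ} (h : 8 ≤ n) (s : Bool) (w : ℤ) {a b : ZMod n ⊕ ZMod n}
    (hab : (generalizedPetersen n 3).Adj a b) : potential n s w a ≤ potential n s w b + 1 := by
  have hn : (0 : ℤ) < n := by omega
  rw [generalizedPetersen, SimpleGraph.fromEdgeSet_adj] at hab
  obtain ⟨⟨i, hi⟩, -⟩ := hab
  obtain ⟨k, hk⟩ : ∃ k : ℤ, i = ((w + k : ℤ) : ZMod n) ∧ 0 ≤ k ∧ k < n := by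
    obtain ⟨j, rfl⟩ := ZMod.intCast_surjective i
    refine ⟨(j - w) % n, ?_, Int.emod_nonneg _ hn.ne', Int.emod_lt_of_pos _ hn⟩
    rw [ZMod.intCast_eq_intCast_iff]
    simpa using ((Int.mod_modEq (j - w) n).add_left w).symm
  obtain ⟨rfl, h0, h1⟩ := hk
  -- An edge is an unordered pair, so both Lipschitz inequalities are needed.
  have aux : ∀ {c d : ZMod n ⊕ ZMod n}, potential n s w d ≤ potential n s w c + 1 ∧
      potential n s w c ≤ potential n s w d + 1 → s(a, b) = s(c, d) →
      potential n s w a ≤ potential n s w b + 1 := by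
    intro c d hcd e
    rcases Sym2.eq_iff.1 e with ⟨rfl, rfl⟩ | ⟨rfl, rfl⟩
    · exact hcd.2
    · exact hcd.1
  have e1 : ((w + k : ℤ) : ZMod n) + 1 = ((w + (k + 1) : ℤ) : ZMod n) := by push_cast; ring
  have e3 : ((w + k : ℤ) : ZMod n) + (3 : ℕ) = ((w + (k + 3) : ℤ) : ZMod n) := by push_cast; ring
  have hp : ∀ (t : Bool) (j : ℤ), potential n s w (vtx n t (w + j)) = ringDist n s t j := by
    intro t j
    rw [potential_vtx (by omega), add_sub_cancel_left]
  rw [e1, e3] at hi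
  rcases hi with hi | hi | hi
  · refine aux (c := vtx n false (w + k)) (d := vtx n false (w + (k + 1))) ?_ hi
    rw [hp, hp]
    exact ringDist_step_outer h s h0 h1
  · refine aux (c := vtx n false (w + k)) (d := vtx n true (w + k)) ?_ hi
    rw [hp, hp]
    exact ringDist_step_spoke s h0 h1
  · refine aux (c := vtx n true (w + k)) (d := vtx n true (w + (k + 3))) ?_ hi
    rw [hp, hp]
    exact ringDist_step_inner h s h0 h1

theorem potential_le_length {n : ℕ} (h : 8 ≤ n) (s : Bool) (w : ℤ) {a b : ZMod n ⊕ ZMod n}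
    (p : (generalizedPetersen n 3).Walk a b) :
    potential n s w a ≤ potential n s w b + p.length := by
  induction p with
  | nil => simp
  | cons hadj p ih =>
    have := potential_adj h s w hadj
    rw [SimpleGraph.Walk.length_cons]
    omega

theorem ringDist_self {n : ℕ} (s : Bool) : ringDist n s s 0 = 0 := by
  rw [ringDist_of_mem s s le_rfl (by omega)]
  cases s <;> simp [lineDist_false_false, lineDist_true_true]

theorem dist_vtx {n : ℕ} (h : 8 ≤ n) (s t : Bool) (w x : ℤ) :
    (generalizedPetersen n 3).dist (vtx n t x) (vtx n s w) = ringDist n s t (x - w) := by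
  obtain ⟨p, hp⟩ := within_ringDist (show 4 ≤ n by omega) s t w x
  refine le_antisymm ((SimpleGraph.dist_le p).trans hp) ?_
  obtain ⟨q, hq⟩ := p.reachable.exists_walk_length_eq_dist
  have := potential_le_length h s w q
  rwa [potential_vtx (by omega), potential_vtx (by omega), sub_self, ringDist_self, zero_add,
    hq] at this

/-! ### Pairs of vertices confused by a landmark -/

/-- The eight shapes `(t, t', δ)` of pairs `{(t, p), (t', p + δ)}` used for the lower bound. -/
def shape : ℕ → Bool × Bool × ℕ
  | 0 => (true, false, 5)
  | 1 => (false, true, 5)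
  | 2 => (false, false, 5)
  | 3 => (true, true, 4)
  | 4 => (false, false, 4)
  | 5 => (true, false, 3)
  | 6 => (true, true, 1)
  | _ => (false, false, 2)

theorem shape_le (j : ℕ) : (shape j).2.2 ≤ 5 := by
  unfold shape
  split <;> simp

/-- A landmark of type `s` at position `0` does not resolve the pair of shape `j` at position
`k`. -/
def Confused (n : ℕ) (s : Bool) (j : ℕ) (k : ℤ) : Prop :=
  ringDist n s (shape j).1 k = ringDist n s (shape j).2.1 (k + (shape j).2.2)

theorem Confused.congr {n : ℕ} {s : Bool} {j : ℕ} {k l : ℤ} (h : Confused n s j k)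
    (hkl : k ≡ l [ZMOD n]) : Confused n s j l := by
  unfold Confused at h ⊢
  rwa [← ringDist_congr _ _ hkl, ← ringDist_congr _ _ (hkl.add_right _)]

def confusedTest (n : ℕ) (s : Bool) (j k : ℕ) : Bool :=
  Nat.beq (cycDist n s (shape j).1 k) (cycDist n s (shape j).2.1 (Nat.add k (shape j).2.2))

theorem confused_of_test {n : ℕ} {s : Bool} {j k : ℕ} (h : confusedTest n s j k = true) :
    Confused n s j k := by
  have h := Nat.eq_of_beq_eq_true h
  rw [← ringDist_natCast, ← ringDist_natCast] at h
  rw [Confused, h]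
  congr 1

/-! ### Kernel computation for triples of landmarks -/

/-- Apply `f` to the evaluated value of `m`: this makes kernel reduction evaluate `m` once. -/
def withValue {α : Type} (m : ℕ) (f : ℕ → α) : α :=
  Nat.rec (f 0) (fun k _ => f (Nat.succ k)) m

@[simp] theorem withValue_eq {α : Type} (m : ℕ) (f : ℕ → α) : withValue m f = f m := by
  cases m <;> rfl

/-- The number whose bits `i < m` are those with `P i`. -/
def bitmask (P : ℕ → Bool) (m : ℕ) : ℕ :=
  Nat.rec 0 (fun i acc => cond (P i) (acc ||| 1 <<< i) acc) m

theorem testBit_one_shiftLeft {m i : ℕ} (h : (1 <<< m).testBit i = true) : i = m := by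
  rw [Nat.one_shiftLeft, Nat.testBit_two_pow] at h
  simpa [eq_comm] using h

theorem of_testBit_bitmask {P : ℕ → Bool} {m i : ℕ} (h : (bitmask P m).testBit i = true) :
    i < m ∧ P i = true := by
  induction m with
  | zero => simp [bitmask] at h
  | succ m ih =>
    change (cond (P m) (bitmask P m ||| 1 <<< m) (bitmask P m)).testBit i = true at h
    cases hP : P m with
    | false =>
      rw [hP] at h
      exact ⟨(ih h).1.trans m.lt_succ_self, (ih h).2⟩
    | true =>
      rw [hP, cond_true, Nat.testBit_or, Bool.or_eq_true] at h
      rcases h with h | h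
      · exact ⟨(ih h).1.trans m.lt_succ_self, (ih h).2⟩
      · obtain rfl := testBit_one_shiftLeft h
        exact ⟨i.lt_succ_self, hP⟩

/-- Bare recursors and `cond`, here and in the other tests, keep kernel evaluation cheap. -/
def forallBelow (m : ℕ) (P : ℕ → Bool) : Bool :=
  Nat.rec true (fun i acc => cond (P i) acc false) m

theorem of_forallBelow {m : ℕ} {P : ℕ → Bool} (h : forallBelow m P = true) {i : ℕ} (hi : i < m) :
    P i = true := by
  induction m with
  | zero => omega
  | succ m ih =>
    change cond (P m) (forallBelow m P) false = true at h
    cases hP : P m with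
    | false => simp [hP] at h
    | true =>
      rw [hP, cond_true] at h
      rcases Nat.lt_succ_iff_lt_or_eq.1 hi with hi | rfl
      · exact ih h hi
      · exact hP

/-- Bit `2 k + s` tells whether a landmark of type `s` at position `k` confuses the pair of shape
`j` at position `0`. -/
def baseRow (n j : ℕ) : ℕ :=
  bitmask (fun i => confusedTest n (Nat.beq (Nat.mod i 2) 1) j (Nat.sub n (Nat.div i 2))) (2 * n)

/-- The landmarks, encoded as `2 k + s`, that confuse the pair of shape `j` at position `p`, where
`V = baseRow n j`. -/
def row (n V p : ℕ) : ℕ := (V <<< (2 * p) ||| V >>> (2 * n - 2 * p)) % 2 ^ (2 * n)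

theorem of_testBit_row {n j p c : ℕ} (hp : p ≤ n)
    (h : (row n (baseRow n j) p).testBit c = true) :
    Confused n (Nat.beq (c % 2) 1) j (p - (c / 2 : ℕ)) := by
  have key : ∀ i, i % 2 = c % 2 → ((n - i / 2 : ℕ) : ℤ) ≡ p - (c / 2 : ℕ) [ZMOD n] →
      (baseRow n j).testBit i = true → Confused n (Nat.beq (c % 2) 1) j (p - (c / 2 : ℕ)) := by
    intro i hi hmod hb
    have hc := (of_testBit_bitmask hb).2
    have hc := (confused_of_test hc).congr hmod
    rwa [← hi]
  rw [row, Nat.testBit_mod_two_pow, Nat.testBit_or, Nat.testBit_shiftLeft, Nat.testBit_shiftRight]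
    at h
  simp only [ge_iff_le, Bool.and_eq_true, decide_eq_true_eq, Bool.or_eq_true] at h
  -- A row is a cyclic rotation by `2 * p` bits: either bit `c` was shifted up from `c - 2 * p`, or
  -- it wrapped around from `c + 2 * n - 2 * p`.
  obtain ⟨-, ⟨h1, h⟩ | h⟩ := h
  · have hlt := (of_testBit_bitmask h).1
    refine key _ (by omega) ?_ h
    refine Int.modEq_iff_dvd.2 ⟨-1, ?_⟩
    omega
  · have hlt := (of_testBit_bitmask h).1
    refine key _ (by omega) ?_ h
    refine Int.modEq_iff_dvd.2 ⟨0, ?_⟩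
    omega

/-- Pass the list of `f i`, `i < m`, followed by `l`, to `K`. -/
def collect (f : ℕ → ℕ) (m : ℕ) : List ℕ → (List ℕ → Bool) → Bool :=
  Nat.rec (fun l K => K l) (fun i ih l K => withValue (f i) fun v => ih (v :: l) K) m

theorem of_collect {f : ℕ → ℕ} {m : ℕ} {l : List ℕ} {K : List ℕ → Bool}
    (h : collect f m l K = true) : ∃ l', K l' = true ∧ ∀ v ∈ l', v ∈ l ∨ ∃ i < m, v = f i := by
  induction m generalizing l with
  | zero => exact ⟨l, h, fun v hv => Or.inl hv⟩
  | succ m ih =>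
    change (withValue (f m) fun v => collect f m (v :: l) K) = true at h
    rw [withValue_eq] at h
    obtain ⟨l', hK, hl⟩ := ih h
    refine ⟨l', hK, fun v hv => ?_⟩
    rcases hl v hv with h | ⟨i, hi, h⟩
    · rcases List.mem_cons.1 h with h | h
      · exact Or.inr ⟨m, m.lt_succ_self, h⟩
      · exact Or.inl h
    · exact Or.inr ⟨i, by omega, h⟩

/-- Pass the list of all rows of shapes below `m`, followed by `l`, to `K`. -/
def collectRows (n m : ℕ) : List ℕ → (List ℕ → Bool) → Bool :=
  Nat.rec (fun l K => K l)
    (fun j ih l K => withValue (baseRow n j) fun V => collect (row n V) n l fun l => ih l K) m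

/-- All members of `r` confuse one and the same pair. -/
def Sound (n r : ℕ) : Prop :=
  ∃ (j : ℕ) (p : ℤ), ∀ c, r.testBit c = true → Confused n (Nat.beq (c % 2) 1) j (p - (c / 2 : ℕ))

theorem of_collectRows {n m : ℕ} {l : List ℕ} {K : List ℕ → Bool}
    (hl : ∀ r ∈ l, Sound n r) (h : collectRows n m l K = true) :
    ∃ l', K l' = true ∧ ∀ r ∈ l', Sound n r := by
  induction m generalizing l with
  | zero => exact ⟨l, h, hl⟩
  | succ m ih =>
    change (withValue (baseRow n m) fun V =>
      collect (row n V) n l fun l => collectRows n m l K) = true at h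
    rw [withValue_eq] at h
    obtain ⟨l', h, hl'⟩ := of_collect h
    refine ih (fun r hr => ?_) h
    rcases hl' r hr with hr | ⟨p, hp, rfl⟩
    · exact hl r hr
    · exact ⟨m, p, fun c => of_testBit_row hp.le⟩

def bitTest (r b : ℕ) : Bool := Nat.beq (Nat.mod (Nat.shiftRight r b) 2) 1

theorem testBit_of_bitTest {r b : ℕ} (h : bitTest r b = true) : r.testBit b = true := by
  have h : (r >>> b) % 2 = 1 := Nat.eq_of_beq_eq_true h
  rw [Nat.testBit_eq_decide_div_mod_eq, ← Nat.shiftRight_eq_div_pow, h]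
  rfl

/-- Pass the sublist of `l` of rows containing `b`, followed by `acc`, to `K`. -/
def keepRows (b : ℕ) (K : List ℕ → Bool) (l : List ℕ) : List ℕ → Bool :=
  List.rec K (fun r _ ih acc => cond (bitTest r b) (ih (r :: acc)) (ih acc)) l

theorem of_keepRows {b : ℕ} {K : List ℕ → Bool} {l acc : List ℕ}
    (h : keepRows b K l acc = true) :
    ∃ l', K l' = true ∧ ∀ r ∈ l', r ∈ acc ∨ r ∈ l ∧ r.testBit b = true := by
  induction l generalizing acc with
  | nil => exact ⟨acc, h, fun r hr => Or.inl hr⟩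
  | cons x l ih =>
    change cond (bitTest x b) (keepRows b K l (x :: acc)) (keepRows b K l acc) = true at h
    cases hx : bitTest x b with
    | true =>
      rw [hx, cond_true] at h
      obtain ⟨l', hK, hl⟩ := ih h
      refine ⟨l', hK, fun r hr => ?_⟩
      rcases hl r hr with h | h
      · rcases List.mem_cons.1 h with rfl | h
        · exact Or.inr ⟨List.mem_cons_self, testBit_of_bitTest hx⟩
        · exact Or.inl h
      · exact Or.inr ⟨List.mem_cons_of_mem _ h.1, h.2⟩
    | false =>
      rw [hx, cond_false] at h
      obtain ⟨l', hK, hl⟩ := ih h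
      refine ⟨l', hK, fun r hr => ?_⟩
      rcases hl r hr with h | h
      · exact Or.inl h
      · exact Or.inr ⟨List.mem_cons_of_mem _ h.1, h.2⟩

/-- The rows in `l` containing `b`, together with `acc`, cover `F`. -/
def covers (F b : ℕ) (l : List ℕ) : ℕ → Bool :=
  List.rec (fun _ => false)
    (fun r _ ih acc => cond (bitTest r b)
      (withValue (Nat.lor acc r) fun a => cond (Nat.beq a F) true (ih a)) (ih acc)) l

theorem of_covers {F b c : ℕ} {l : List ℕ} {acc : ℕ} (h : covers F b l acc = true)
    (hc : F.testBit c = true) :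
    acc.testBit c = true ∨ ∃ r ∈ l, r.testBit b = true ∧ r.testBit c = true := by
  induction l generalizing acc with
  | nil => cases h
  | cons x l ih =>
    change cond (bitTest x b) (withValue (acc ||| x) fun a =>
      cond (Nat.beq a F) true (covers F b l a)) (covers F b l acc) = true at h
    have lift : (∃ r ∈ l, r.testBit b = true ∧ r.testBit c = true) →
        ∃ r ∈ x :: l, r.testBit b = true ∧ r.testBit c = true :=
      fun ⟨r, hr, h⟩ => ⟨r, List.mem_cons_of_mem _ hr, h⟩
    cases hx : bitTest x b with
    | false =>
      rw [hx, cond_false] at h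
      exact (ih h).imp_right lift
    | true =>
      rw [hx, cond_true, withValue_eq] at h
      have h : (acc ||| x).testBit c = true ∨
          ∃ r ∈ l, r.testBit b = true ∧ r.testBit c = true := by
        cases hF : Nat.beq (acc ||| x) F with
        | true => exact Or.inl (by rwa [Nat.eq_of_beq_eq_true hF])
        | false =>
          rw [hF, cond_false] at h
          exact ih h
      rw [Nat.testBit_or, Bool.or_eq_true] at h
      rcases h with (h | h) | h
      · exact Or.inl h
      · exact Or.inr ⟨x, List.mem_cons_self, testBit_of_bitTest hx, h⟩
      · exact Or.inr (lift h)

/-- Check that for any three landmarks, the first one at position `0`, some pair of one of the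
eight shapes is confused by all of them. -/
def tripleTest (n : ℕ) : Bool :=
  withValue (2 ^ (2 * n) - 1) fun F =>
  collectRows n 8 [] fun rows =>
  forallBelow 2 fun s =>
  keepRows s (fun rows' => forallBelow (2 * n) fun b => covers F b rows' 0) rows []

/-- For all `m` landmarks, some pair of one of the eight shapes is confused by all of them. -/
def AllConfuse (n m : ℕ) : Prop :=
  ∀ (s : Fin m → Bool) (a : Fin m → ℤ), ∃ (j : ℕ) (p : ℤ), ∀ i, Confused n (s i) j (p - a i)

/-- The rows through `s` and `b` together cover every landmark, so one of them also contains `c`;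
that row is the common confused pair. -/
theorem exists_of_tripleTest {n : ℕ} (h : tripleTest n = true) {s b c : ℕ}
    (hs : s < 2) (hb : b < 2 * n) (hc : c < 2 * n) :
    ∃ (j : ℕ) (p : ℤ), ∀ x ∈ [s, b, c], Confused n (Nat.beq (x % 2) 1) j (p - (x / 2 : ℕ)) := by
  rw [tripleTest, withValue_eq] at h
  obtain ⟨rows, h, hrows⟩ := of_collectRows (by simp) h
  obtain ⟨rows', h, hrows'⟩ := of_keepRows (of_forallBelow h hs)
  have hF : (2 ^ (2 * n) - 1).testBit c = true := by
    rw [Nat.testBit_two_pow_sub_one]; simpa using hc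
  obtain h | ⟨r, hr, hrb, hrc⟩ := of_covers (of_forallBelow h hb) hF
  · simp at h
  obtain hr | ⟨hr, hrs⟩ := hrows' r hr
  · simp at hr
  obtain ⟨j, p, hX⟩ := hrows r hr
  refine ⟨j, p, fun x hx => ?_⟩
  simp only [List.mem_cons, List.not_mem_nil, or_false] at hx
  rcases hx with rfl | rfl | rfl
  · exact hX _ hrs
  · exact hX _ hrb
  · exact hX _ hrc

/-- By rotation the first landmark may be placed at 0. -/
theorem allConfuse_of_tripleTest {n : ℕ} (h0 : 0 < n) (h : tripleTest n = true) :
    AllConfuse n 3 := by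
  intro s a
  have hn' : (0 : ℤ) < n := by omega
  have hpos := fun i => Int.emod_nonneg (a i - a 0) hn'.ne'
  have hlt := fun i => Int.emod_lt_of_pos (a i - a 0) hn'
  let e : Fin 3 → ℕ := fun i => 2 * ((a i - a 0) % n).toNat + (s i).toNat
  have hs := fun i => Bool.toNat_lt (s i)
  have he : ∀ i, e i < 2 * n := by
    intro i
    have := hpos i; have := hlt i; have := hs i
    simp only [e]
    omega
  have he0 : e 0 < 2 := by simpa [e] using hs 0
  obtain ⟨j, p, hp⟩ := exists_of_tripleTest h he0 (he 1) (he 2)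
  refine ⟨j, p + a 0, fun i => ?_⟩
  have hi : e i ∈ [e 0, e 1, e 2] := by fin_cases i <;> simp
  have hc := hp _ hi
  have e1 : Nat.beq (e i % 2) 1 = s i := by
    simp only [e]
    cases s i <;> (simp [Nat.add_mod]; try rfl)
  have e2 : ((e i / 2 : ℕ) : ℤ) = (a i - a 0) % n := by
    have := hpos i; have := hs i
    simp only [e]
    omega
  rw [e1, e2] at hc
  refine hc.congr ?_
  have := (Int.mod_modEq (a i - a 0) n).sub_left p
  rwa [show p + a 0 - a i = p - (a i - a 0) by ring]

theorem tripleTest_of_mod_eq_two : forallBelow 11 (fun k => tripleTest (6 * k + 38)) = true := by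
  decide +kernel

theorem tripleTest_of_mod_eq_three : forallBelow 11 (fun k => tripleTest (6 * k + 39)) = true := by
  decide +kernel

theorem tripleTest_of_mod_eq_four : forallBelow 11 (fun k => tripleTest (6 * k + 40)) = true := by
  decide +kernel

theorem tripleTest_of_mod_eq_five : forallBelow 11 (fun k => tripleTest (6 * k + 41)) = true := by
  decide +kernel

theorem allConfuse_of_lt {n : ℕ} (h : 36 ≤ n) (h' : n < 102) (hmod : 2 ≤ n % 6) :
    AllConfuse n 3 := by
  refine allConfuse_of_tripleTest (by omega) ?_
  have h4 : n % 6 = 2 ∨ n % 6 = 3 ∨ n % 6 = 4 ∨ n % 6 = 5 := by omega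
  rcases h4 with hr | hr | hr | hr
  · have := of_forallBelow tripleTest_of_mod_eq_two (i := (n - 38) / 6) (by omega)
    rwa [show 6 * ((n - 38) / 6) + 38 = n by omega] at this
  · have := of_forallBelow tripleTest_of_mod_eq_three (i := (n - 39) / 6) (by omega)
    rwa [show 6 * ((n - 39) / 6) + 39 = n by omega] at this
  · have := of_forallBelow tripleTest_of_mod_eq_four (i := (n - 40) / 6) (by omega)
    rwa [show 6 * ((n - 40) / 6) + 40 = n by omega] at this
  · have := of_forallBelow tripleTest_of_mod_eq_five (i := (n - 41) / 6) (by omega)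
    rwa [show 6 * ((n - 41) / 6) + 41 = n by omega] at this

/-! ### Lower bound: from `n` to `n + 6` -/

theorem Confused.add_six_near {n : ℕ} {s : Bool} {j : ℕ} {k l : ℤ} (h : Confused n s j k)
    (h0 : 2 * k.natAbs + 10 ≤ n) (h5 : 2 * (k + 5).natAbs + 10 ≤ n)
    (hl : l = k ∨ l = k + (n + 6) ∨ l = k - (n + 6)) : Confused (n + 6) s j l := by
  have := shape_le j
  unfold Confused at h ⊢
  rw [ringDist_add_six_near s _ h0 hl, ringDist_add_six_near s _ (k := k + (shape j).2.2)
    (by omega) (by omega), h]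

theorem Confused.add_six_far {n : ℕ} {s : Bool} {j : ℕ} {k l : ℤ} (h : Confused n s j k)
    (h0 : 3 ≤ k) (h5 : k + 8 ≤ n) (hl : l = k + 3 ∨ l = k - n - 3) : Confused (n + 6) s j l := by
  have := shape_le j
  unfold Confused at h ⊢
  rw [ringDist_add_six_far s _ h0 (by omega) hl, ringDist_add_six_far s _
    (k := k + (shape j).2.2) (by omega) (by omega) (by omega), h]

/-- Positions far from the cuts at `0` and at the antipode. -/
def AwayFromCuts (n : ℕ) (a : ℕ) : Prop :=
  (9 ≤ a ∧ a + 5 ≤ n / 2) ∨ (n / 2 + 13 ≤ a ∧ a + 2 ≤ 2 * (n / 2))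

instance (n a : ℕ) : Decidable (AwayFromCuts n a) := by unfold AwayFromCuts; infer_instance

theorem exists_confused_add_six {n m : ℕ} (hn : 30 ≤ n) (h : AllConfuse n m) (s : Fin m → Bool)
    (a : Fin m → ℕ) (ha : ∀ i, AwayFromCuts n (a i)) :
    ∃ (j : ℕ) (p : ℤ), ∀ i, Confused (n + 6) (s i) j (p - a i) := by
  -- Deleting positions `n / 2, …, n / 2 + 2` and the last three maps the landmarks to the shorter
  -- cycle. The pair found there is moved back rigidly; the margins allow for its width of at most
  -- 5, even across a cut.
  obtain ⟨j, p, hp⟩ := h s (fun i => if a i < n / 2 then (a i : ℤ) else a i - 3)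
  obtain ⟨q, hq0, hq1, hq⟩ : ∃ q : ℤ, 0 ≤ q ∧ q < n ∧ q ≡ p [ZMOD n] :=
    ⟨p % n, Int.emod_nonneg _ (by omega), Int.emod_lt_of_pos _ (by omega), Int.mod_modEq _ _⟩
  refine ⟨j, if q < (n / 2 : ℕ) then q else q + 3, fun i => ?_⟩
  have hc := (hp i).congr (hq.symm.sub_right _)
  have hi := ha i
  unfold AwayFromCuts at hi
  by_cases h1 : a i < n / 2 <;> by_cases h2 : q < (n / 2 : ℕ) <;> simp only [h1, h2, if_true,
    if_false] at hc ⊢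
  · exact hc.add_six_near (by omega) (by omega) (by omega)
  · exact hc.add_six_far (by omega) (by omega) (by omega)
  · refine (hc.congr (l := q - (a i - 3) + n) (by simp [Int.ModEq])).add_six_far ?_ ?_ ?_ <;> omega
  · exact hc.add_six_near (by omega) (by omega) (by omega)

/-- The forbidden positions lie in intervals of sizes 9, 17 and 8. -/
theorem card_filter_not_awayFromCuts (n : ℕ) :
    ((Finset.range (n + 6)).filter fun a => ¬ AwayFromCuts n a).card ≤ 34 := by
  have hsub : ((Finset.range (n + 6)).filter fun a => ¬ AwayFromCuts n a) ⊆
      Finset.range 9 ∪ (Finset.Ico (n / 2 - 4) (n / 2 + 13) ∪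
        Finset.Ico (2 * (n / 2) - 1) (2 * (n / 2) + 7)) := by
    intro a ha
    obtain ⟨ha, hcut⟩ := Finset.mem_filter.1 ha
    simp only [Finset.mem_range, AwayFromCuts, Finset.mem_union, Finset.mem_Ico] at ha hcut ⊢
    omega
  refine (Finset.card_le_card hsub).trans ((Finset.card_union_le _ _).trans ?_)
  have := Finset.card_union_le (Finset.Ico (n / 2 - 4) (n / 2 + 13))
    (Finset.Ico (2 * (n / 2) - 1) (2 * (n / 2) + 7))
  simp only [Nat.card_Ico, Finset.card_range] at this ⊢
  omega

/-- Each landmark rules out at most 34 of the `n + 6` rotations. -/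
theorem exists_cut {n m : ℕ} (hn : m * 34 < n + 6) (a : Fin m → ℤ) :
    ∃ z : ℤ, ∀ i, AwayFromCuts n ((a i - z) % (n + 6 : ℕ)).toNat := by
  by_contra! hcon
  let B := (Finset.range (n + 6)).filter fun a => ¬ AwayFromCuts n a
  let T := (Finset.univ : Finset (Fin m)).biUnion fun i =>
    B.image fun b : ℕ => ((a i - b) % (n + 6 : ℕ))
  have hT : T.card ≤ m * 34 := by
    refine (Finset.card_biUnion_le_card_mul _ _ 34 fun i _ => ?_).trans (by simp)
    exact Finset.card_image_le.trans (card_filter_not_awayFromCuts n)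
  have hsub : (Finset.range (n + 6)).image (fun z : ℕ => (z : ℤ)) ⊆ T := by
    intro z hz
    obtain ⟨z, hz', rfl⟩ := Finset.mem_image.1 hz
    obtain ⟨i, hi⟩ := hcon z
    have hpos := Int.emod_nonneg (a i - z) (b := ((n + 6 : ℕ) : ℤ)) (by omega)
    have hlt := Int.emod_lt_of_pos (a i - z) (b := ((n + 6 : ℕ) : ℤ)) (by omega)
    refine Finset.mem_biUnion.2 ⟨i, Finset.mem_univ _, Finset.mem_image.2
      ⟨_, Finset.mem_filter.2 ⟨Finset.mem_range.2 ?_, hi⟩, ?_⟩⟩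
    · omega
    · rw [Int.toNat_of_nonneg hpos]
      have h1 := (Int.mod_modEq (a i - z) (n + 6 : ℕ)).sub_left (a i)
      rw [sub_sub_cancel] at h1
      rw [h1.eq]
      exact Int.emod_eq_of_lt (by omega) (by exact_mod_cast Finset.mem_range.1 hz')
  have := Finset.card_le_card hsub
  rw [Finset.card_image_of_injective _ Nat.cast_injective, Finset.card_range] at this
  omega

theorem AllConfuse.add_six {n m : ℕ} (h0 : 30 ≤ n) (hn : m * 34 < n + 6) (h : AllConfuse n m) :
    AllConfuse (n + 6) m := by
  intro s a
  obtain ⟨z, hz⟩ := exists_cut hn a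
  obtain ⟨j, p, hp⟩ := exists_confused_add_six h0 h s _ hz
  refine ⟨j, p + z, fun i => (hp i).congr ?_⟩
  rw [Int.toNat_of_nonneg (Int.emod_nonneg _ (by omega))]
  have := (Int.mod_modEq (a i - z) (n + 6 : ℕ)).sub_left p
  rwa [show p + z - a i = p - (a i - z) by ring]

theorem allConfuse {n : ℕ} (h : 36 ≤ n) (hmod : 2 ≤ n % 6) : AllConfuse n 3 := by
  induction n using Nat.strong_induction_on with
  | _ n ih =>
    rcases lt_or_ge n 102 with hn | hn
    · exact allConfuse_of_lt h hn hmod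
    · obtain ⟨k, rfl⟩ : ∃ k, n = k + 6 := ⟨n - 6, by omega⟩
      -- The strict bound `3 * 34 < n` holds because 102 itself is divisible by 6.
      exact (ih k (by omega) (by omega) (by omega)).add_six (by omega) (by omega)

/-- A set contained in three landmarks is not resolving. -/
theorem not_isResolvingSet {n : ℕ} (h : 36 ≤ n) (hmod : 2 ≤ n % 6)
    {W : Finset (ZMod n ⊕ ZMod n)} (hW : W.card ≤ 3) :
    ¬ (generalizedPetersen n 3).IsResolvingSet W := by
  intro hres
  obtain ⟨f, hf⟩ : ∃ f : Fin 3 → ZMod n ⊕ ZMod n, ∀ w ∈ W, ∃ i, f i = w := by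
    -- The default vertex is arbitrary: extra landmarks only strengthen the statement.
    refine ⟨fun i => W.toList.getD i (Sum.inl 0), fun w hw => ?_⟩
    obtain ⟨i, hi, rfl⟩ := List.mem_iff_getElem.1 (Finset.mem_toList.2 hw)
    have hi' : i < 3 := by rw [Finset.length_toList] at hi; omega
    exact ⟨⟨i, hi'⟩, by simp [List.getD_eq_getElem?_getD, List.getElem?_eq_getElem hi]⟩
  choose s a hsa using fun i => exists_vtx (f i)
  obtain ⟨j, p, hp⟩ := allConfuse h hmod s a
  have heq := hres (vtx n (shape j).1 p) (vtx n (shape j).2.1 (p + (shape j).2.2)) (by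
    intro w hw
    obtain ⟨i, rfl⟩ := hf w hw
    rw [hsa, dist_vtx (by omega), dist_vtx (by omega), add_sub_right_comm]
    exact hp i)
  have hcast := fun d (h0 : 0 < d) (h5 : d < n) => intCast_ne_add (n := n) p (m := d) h0 h5
  unfold shape at heq
  -- Pairs joining an outer to an inner vertex are distinct by type; the other five need their
  -- offset to be nonzero modulo `n`.
  split at heq <;> simp [vtx] at heq
  · exact hcast 5 (by omega) (by omega) (by simpa using heq)
  · exact hcast 4 (by omega) (by omega) (by simpa using heq)
  · exact hcast 4 (by omega) (by omega) (by simpa using heq)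
  · exact hcast 1 (by omega) (by omega) (by simpa using heq)
  · exact hcast 2 (by omega) (by omega) (by simpa using heq)

/-! ### Upper bound: four landmarks -/

/-- The landmarks `(s, c, e)`: of type `s`, at position `c`, or `n / 2 + c` if `e`. The first
family is for `n ≡ 2 [MOD 6]`. -/
def landmark : Bool → Fin 4 → Bool × ℕ × Bool
  | true, 0 => (false, 0, false)
  | true, 1 => (true, 1, false)
  | true, 2 => (true, 3, true)
  | true, 3 => (false, 4, true)
  | false, 0 => (false, 0, false)
  | false, 1 => (true, 2, false)
  | false, 2 => (true, 3, false)
  | false, 3 => (true, 4, false)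

def landmarkPos (n : ℕ) (l : Bool × ℕ × Bool) : ℕ :=
  cond l.2.2 (Nat.add (Nat.div n 2) l.2.1) l.2.1

theorem landmark_le (b : Bool) (i : Fin 4) : (landmark b i).2.1 ≤ 4 := by
  revert b i; decide

/-- Distances to the landmarks determine a vertex. -/
def Separates (b : Bool) (n : ℕ) : Prop :=
  ∀ (t t' : Bool) (x x' : ℤ),
    (∀ i, ringDist n (landmark b i).1 t (x - landmarkPos n (landmark b i)) =
      ringDist n (landmark b i).1 t' (x' - landmarkPos n (landmark b i))) →
    t = t' ∧ x ≡ x' [ZMOD n]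

/-- The distance between landmark `l` and the vertex encoded by `2 x + t`. -/
def landmarkDist (n : ℕ) (l : Bool × ℕ × Bool) (v : ℕ) : ℕ :=
  cycDist n l.1 (Nat.beq (Nat.mod v 2) 1) (Nat.sub (Nat.add (Nat.div v 2) n) (landmarkPos n l))

/-- Equal distances give equal codes, which is all that is used; no bound by 64 on the distances is
needed. -/
def code (b : Bool) (n v : ℕ) : ℕ :=
  landmarkDist n (landmark b 0) v + 64 * (landmarkDist n (landmark b 1) v +
    64 * (landmarkDist n (landmark b 2) v + 64 * landmarkDist n (landmark b 3) v))

def notMem (v : ℕ) (l : List ℕ) : Bool :=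
  List.rec true (fun x _ ih => cond (Nat.beq x v) false ih) l

theorem of_notMem {v : ℕ} {l : List ℕ} (h : notMem v l = true) : v ∉ l := by
  induction l with
  | nil => simp
  | cons x l ih =>
    change cond (Nat.beq x v) false (notMem v l) = true at h
    cases hx : Nat.beq x v with
    | true => simp [hx] at h
    | false =>
      rw [hx, cond_false] at h
      rw [List.mem_cons, not_or]
      exact ⟨fun e => by simp [e] at hx, ih h⟩

/-- The values `f i`, `i < m`, are distinct and not in the given list. -/
def distinctTest (f : ℕ → ℕ) (m : ℕ) : List ℕ → Bool :=
  Nat.rec (fun _ => true) (fun i ih l =>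
    withValue (f i) fun v => cond (notMem v l) (ih (v :: l)) false) m

theorem of_distinctTest {f : ℕ → ℕ} {m : ℕ} {l : List ℕ} (h : distinctTest f m l = true) :
    (∀ i < m, f i ∉ l) ∧ ∀ i < m, ∀ j < m, f i = f j → i = j := by
  induction m generalizing l with
  | zero => simp
  | succ m ih =>
    change (withValue (f m) fun v => cond (notMem v l) (distinctTest f m (v :: l)) false) = true
      at h
    rw [withValue_eq] at h
    cases hm : notMem (f m) l with
    | false => simp [hm] at h
    | true =>
      rw [hm, cond_true] at h
      obtain ⟨h1, h2⟩ := ih h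
      have hne : ∀ i < m, f i ≠ f m := fun i hi e => h1 i hi (e ▸ List.mem_cons_self)
      refine ⟨fun i hi => ?_, fun i hi j hj e => ?_⟩
      · rcases Nat.lt_succ_iff_lt_or_eq.1 hi with hi | rfl
        · exact fun hl => h1 i hi (List.mem_cons_of_mem _ hl)
        · exact of_notMem hm
      · rcases Nat.lt_succ_iff_lt_or_eq.1 hi with hi | rfl <;>
          rcases Nat.lt_succ_iff_lt_or_eq.1 hj with hj | rfl
        · exact h2 i hi j hj e
        · exact absurd e (hne i hi)
        · exact absurd e.symm (hne j hj)
        · rfl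

theorem separates_of_distinctTest {b : Bool} {n : ℕ} (hn : 10 ≤ n)
    (h : distinctTest (code b n) (2 * n) [] = true) : Separates b n := by
  intro t t' x x' hd
  have hn' : (0 : ℤ) < n := by omega
  have key : ∀ (t : Bool) (x : ℤ), ∃ v < 2 * n, (v % 2 = t.toNat ∧ ((v / 2 : ℕ) : ℤ) = x % n) ∧
      ∀ i, landmarkDist n (landmark b i) v =
        ringDist n (landmark b i).1 t (x - landmarkPos n (landmark b i)) := by
    intro t x
    have h0 := Int.emod_nonneg x hn'.ne'
    have h1 := Int.emod_lt_of_pos x hn'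
    have ht := Bool.toNat_lt t
    refine ⟨2 * (x % n).toNat + t.toNat, by omega, by omega, fun i => ?_⟩
    have hc := landmark_le b i
    have hpos : landmarkPos n (landmark b i) ≤ n := by
      unfold landmarkPos
      cases (landmark b i).2.2
      · exact hc.trans (by omega)
      · change n / 2 + _ ≤ n
        omega
    change cycDist n _ (Nat.beq ((2 * (x % n).toNat + t.toNat) % 2) 1)
      ((2 * (x % n).toNat + t.toNat) / 2 + n - landmarkPos n (landmark b i)) = _
    have e1 : Nat.beq ((2 * (x % n).toNat + t.toNat) % 2) 1 = t := by
      rw [show (2 * (x % n).toNat + t.toNat) % 2 = t.toNat by omega]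
      cases t <;> rfl
    rw [e1, ← ringDist_natCast]
    apply ringDist_congr
    rw [show (((2 * (x % n).toNat + t.toNat) / 2 + n - landmarkPos n (landmark b i) : ℕ) : ℤ) =
      x % n - landmarkPos n (landmark b i) + n by omega]
    refine Int.ModEq.trans (b := x % n - landmarkPos n (landmark b i)) (by simp [Int.ModEq]) ?_
    exact (Int.mod_modEq x n).sub_right _
  obtain ⟨v, hv, ⟨hvt, hvx⟩, hvd⟩ := key t x
  obtain ⟨v', hv', ⟨hvt', hvx'⟩, hvd'⟩ := key t' x'
  have hvv : ∀ i, landmarkDist n (landmark b i) v = landmarkDist n (landmark b i) v' := by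
    intro i
    rw [hvd, hvd', hd]
  obtain rfl := (of_distinctTest h).2 v hv v' hv' (by simp only [code, hvv])
  refine ⟨?_, ?_⟩
  · have : t.toNat = t'.toNat := by omega
    revert this
    cases t <;> cases t' <;> simp
  · rw [Int.ModEq, ← hvx, ← hvx']

theorem distinctTest_of_mod_eq_two :
    forallBelow 5 (fun k => distinctTest (code true (6 * k + 38)) (2 * (6 * k + 38)) []) =
      true := by
  decide +kernel

theorem distinctTest_of_mod_ne_two :
    forallBelow 5 (fun k => forallBelow 3 fun r =>
      distinctTest (code false (6 * k + 39 + r)) (2 * (6 * k + 39 + r)) []) = true := by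
  decide +kernel

theorem separates_of_lt {n : ℕ} (h : 36 ≤ n) (h' : n < 66) (hmod : 2 ≤ n % 6) :
    Separates (decide (n % 6 = 2)) n := by
  refine separates_of_distinctTest (by omega) ?_
  by_cases hr : n % 6 = 2
  · have := of_forallBelow distinctTest_of_mod_eq_two (i := (n - 38) / 6) (by omega)
    rw [show 6 * ((n - 38) / 6) + 38 = n by omega] at this
    simpa only [hr, decide_true] using this
  · have := of_forallBelow (of_forallBelow distinctTest_of_mod_ne_two (i := (n - 39) / 6)
      (by omega)) (i := n % 6 - 3) (by omega)
    rw [show 6 * ((n - 39) / 6) + 39 + (n % 6 - 3) = n by omega] at this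
    simpa only [hr, decide_false] using this

/-! ### Upper bound: from `n` to `n + 6` -/

/-- Removing three positions on each side leaves the distances from a landmark to vertices near
`0` unchanged up to a constant. -/
theorem landmark_near {n : ℕ} (hn : 60 ≤ n) (b : Bool) (i : Fin 4) (t : Bool) {x : ℤ}
    (hx : 2 * x.natAbs + 20 ≤ n) :
    ringDist (n + 6) (landmark b i).1 t (x - landmarkPos (n + 6) (landmark b i)) =
      ringDist n (landmark b i).1 t (x - landmarkPos n (landmark b i)) +
        (landmark b i).2.2.toNat := by
  have hc := landmark_le b i
  generalize landmark b i = l at hc ⊢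
  obtain ⟨s, c, e⟩ := l
  change c ≤ 4 at hc
  cases e
  · exact ringDist_add_six_near s t (k := x - c) (by omega) (Or.inl rfl)
  · change ringDist (n + 6) s t (x - ((n + 6) / 2 + c : ℕ)) =
      ringDist n s t (x - (n / 2 + c : ℕ)) + 1
    rw [← ringDist_add n]
    exact ringDist_add_six_far s t (by omega) (by omega) (Or.inr (by omega))

theorem landmark_far {n : ℕ} (hn : 60 ≤ n) (b : Bool) (i : Fin 4) (t : Bool) {x y : ℤ}
    (hy : 9 ≤ y.natAbs) (hy' : 2 * y.natAbs ≤ n) (hx : x = if 0 ≤ y then y + 3 else y - 3) :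
    ringDist (n + 6) (landmark b i).1 t (x - landmarkPos (n + 6) (landmark b i)) =
      ringDist n (landmark b i).1 t (y - landmarkPos n (landmark b i)) +
        (!(landmark b i).2.2).toNat := by
  have hc := landmark_le b i
  generalize landmark b i = l at hc ⊢
  obtain ⟨s, c, e⟩ := l
  change c ≤ 4 at hc
  cases e
  · change ringDist (n + 6) s t (x - c) = ringDist n s t (y - c) + 1
    split_ifs at hx
    · exact ringDist_add_six_far s t (by omega) (by omega) (Or.inl (by omega))
    · rw [← ringDist_add n]
      exact ringDist_add_six_far s t (by omega) (by omega) (Or.inr (by omega))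
  · change ringDist (n + 6) s t (x - ((n + 6) / 2 + c : ℕ)) = ringDist n s t (y - (n / 2 + c : ℕ))
    split_ifs at hx
    · exact ringDist_add_six_near s t (by omega) (Or.inl (by omega))
    · rw [← ringDist_add n]
      exact ringDist_add_six_near s t (by omega) (Or.inr (Or.inr (by omega)))

theorem exists_balanced {n : ℕ} (hn : 0 < n) (x : ℤ) :
    ∃ y : ℤ, y ≡ x [ZMOD n] ∧ 2 * y.natAbs ≤ n := by
  have h0 := Int.emod_nonneg x (b := (n : ℤ)) (by omega)
  have h1 := Int.emod_lt_of_pos x (b := (n : ℤ)) (by omega)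
  rcases le_or_gt (2 * (x % n)) n with h | h
  · exact ⟨x % n, Int.mod_modEq _ _, by omega⟩
  · exact ⟨x % n - n, by simp [Int.ModEq], by omega⟩

theorem eq_of_modEq {n : ℕ} {x y : ℤ} (h : x ≡ y [ZMOD n]) (h' : (y - x).natAbs ≤ n) :
    y = x ∨ y = x + n ∨ y = x - n := by
  obtain ⟨q, hq⟩ := h.dvd
  rcases Nat.eq_zero_or_pos n with rfl | hn
  · left; simp at hq; omega
  have h1 : n * q.natAbs ≤ n * 1 := by
    rw [hq, Int.natAbs_mul, Int.natAbs_natCast] at h'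
    omega
  have h2 := Nat.le_of_mul_le_mul_left h1 hn
  have h3 : q = 0 ∨ q = 1 ∨ q = -1 := by omega
  rcases h3 with rfl | rfl | rfl <;> omega

theorem landmark_zero (b : Bool) : landmark b 0 = (false, 0, false) := by cases b <;> rfl

/-- The distance to `u_0` separates vertices near `0` from far ones. -/
theorem lt_of_ringDist_eq {n : ℕ} (hn : 66 ≤ n) {t t' : Bool} {x x' : ℤ} (hx : x.natAbs ≤ 11)
    (hx' : 2 * x'.natAbs ≤ n) (h : ringDist n false t x = ringDist n false t' x') :
    2 * x'.natAbs + 26 ≤ n := by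
  rw [ringDist_eq_lineDist _ _ (by omega), ringDist_of_natAbs_le _ _ (by omega)] at h
  by_contra hcon
  -- Offset at most 11 means distance at most 7 from `u_0`, which forces `x'.natAbs ≤ 18`.
  revert h
  cases t <;> cases t' <;> simp only [lineDist_false_false, lineDist_false_true] <;>
    (try split_ifs) <;> omega

theorem Separates.add_six {b : Bool} {n : ℕ} (hn : 60 ≤ n) (h : Separates b n) :
    Separates b (n + 6) := by
  intro t t' x x' hd
  obtain ⟨y, hy, hyn⟩ := exists_balanced (n := n + 6) (by omega) x
  obtain ⟨y', hy', hyn'⟩ := exists_balanced (n := n + 6) (by omega) x'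
  suffices t = t' ∧ y ≡ y' [ZMOD (n + 6 : ℕ)] from ⟨this.1, hy.symm.trans (this.2.trans hy')⟩
  have hd : ∀ i, ringDist (n + 6) (landmark b i).1 t (y - landmarkPos (n + 6) (landmark b i)) =
      ringDist (n + 6) (landmark b i).1 t' (y' - landmarkPos (n + 6) (landmark b i)) := by
    intro i
    rw [ringDist_congr _ _ (hy.sub_right _), ringDist_congr _ _ (hy'.sub_right _), hd]
  have h0 : ringDist (n + 6) false t y = ringDist (n + 6) false t' y' := by
    simpa [landmark_zero, landmarkPos] using hd 0
  by_cases hnear : 2 * y.natAbs + 20 ≤ n ∧ 2 * y'.natAbs + 20 ≤ n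
  · obtain ⟨ht, hyy⟩ := h t t' y y' fun i => by
      have := hd i
      rw [landmark_near hn b i t hnear.1, landmark_near hn b i t' hnear.2] at this
      omega
    refine ⟨ht, ?_⟩
    have : y' = y := by
      have := eq_of_modEq hyy (by omega)
      omega
    rw [this]
  -- One of the two is close to the antipode; if either were within 11 of 0, the distance to `u_0`
  -- would tell them apart.
  · have hfar : 12 ≤ y.natAbs ∧ 12 ≤ y'.natAbs := by
      by_contra hcon
      have h1 := fun hy => lt_of_ringDist_eq (n := n + 6) (by omega) hy hyn' h0
      have h2 := fun hy' => lt_of_ringDist_eq (n := n + 6) (by omega) hy' hyn h0.symm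
      omega
    obtain ⟨z, hz, hz9, hzn⟩ : ∃ z : ℤ, (y = if 0 ≤ z then z + 3 else z - 3) ∧
        9 ≤ z.natAbs ∧ 2 * z.natAbs ≤ n :=
      ⟨if 0 ≤ y then y - 3 else y + 3, by split_ifs <;> omega, by split_ifs <;> omega,
        by split_ifs <;> omega⟩
    obtain ⟨z', hz', hz9', hzn'⟩ : ∃ z' : ℤ, (y' = if 0 ≤ z' then z' + 3 else z' - 3) ∧
        9 ≤ z'.natAbs ∧ 2 * z'.natAbs ≤ n :=
      ⟨if 0 ≤ y' then y' - 3 else y' + 3, by split_ifs <;> omega, by split_ifs <;> omega,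
        by split_ifs <;> omega⟩
    obtain ⟨ht, hzz⟩ := h t t' z z' fun i => by
      have := hd i
      rw [landmark_far hn b i t hz9 hzn hz, landmark_far hn b i t' hz9' hzn' hz'] at this
      omega
    refine ⟨ht, ?_⟩
    have h3 := eq_of_modEq hzz (by omega)
    -- If `z` and `z'` differ by `n`, they are `n / 2` and `-n / 2`; moving each outward by 3 makes
    -- the difference `n + 6`.
    have h4 : y' = y ∨ y' = y + (n + 6 : ℕ) ∨ y' = y - (n + 6 : ℕ) := by
      split_ifs at hz hz' <;> omega
    rcases h4 with h4 | h4 | h4 <;> rw [h4] <;> simp [Int.ModEq]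

theorem separates {n : ℕ} (h : 36 ≤ n) (hmod : 2 ≤ n % 6) :
    Separates (decide (n % 6 = 2)) n := by
  induction n using Nat.strong_induction_on with
  | _ n ih =>
    rcases lt_or_ge n 66 with hn | hn
    · exact separates_of_lt h hn hmod
    · obtain ⟨k, rfl⟩ : ∃ k, n = k + 6 := ⟨n - 6, by omega⟩
      rw [Nat.add_mod_right]
      exact (ih k (by omega) (by omega) (by omega)).add_six (by omega)

theorem exists_isResolvingSet {n : ℕ} (h : 36 ≤ n) (hmod : 2 ≤ n % 6) :
    ∃ W : Finset (ZMod n ⊕ ZMod n), (generalizedPetersen n 3).IsResolvingSet W ∧ W.card ≤ 4 := by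
  classical
  refine ⟨Finset.univ.image fun i =>
    vtx n (landmark (decide (n % 6 = 2)) i).1 (landmarkPos n (landmark (decide (n % 6 = 2)) i)),
    fun x y hxy => ?_, Finset.card_image_le.trans (by simp)⟩
  obtain ⟨t, k, rfl⟩ := exists_vtx x
  obtain ⟨t', k', rfl⟩ := exists_vtx y
  obtain ⟨rfl, hk⟩ := separates h hmod t t' k k' fun i => by
    have := hxy _ (Finset.mem_image_of_mem _ (Finset.mem_univ i))
    rwa [dist_vtx (by omega), dist_vtx (by omega)] at this
  exact vtx_congr t hk

end GenPetersenThree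

theorem mainTheorem6 (n : ℕ) (hn : 36 ≤ n)
    (hmod : n ≡ 2 [MOD 6] ∨ n ≡ 3 [MOD 6] ∨ n ≡ 4 [MOD 6] ∨ n ≡ 5 [MOD 6]) :
    (generalizedPetersen n 3).metricDim = 4 := by
  have hr : 2 ≤ n % 6 := by
    simp only [Nat.ModEq] at hmod
    omega
  obtain ⟨W, hW, hcard⟩ := GenPetersenThree.exists_isResolvingSet hn hr
  have hmem : W.card ∈ {k : ℕ | ∃ W : Finset (ZMod n ⊕ ZMod n),
      (generalizedPetersen n 3).IsResolvingSet W ∧ W.card = k} := ⟨W, hW, rfl⟩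
  refine le_antisymm ((Nat.sInf_le hmem).trans hcard) (le_csInf ⟨_, hmem⟩ ?_)
  rintro _ ⟨W', hW', rfl⟩
  by_contra hlt
  exact GenPetersenThree.not_isResolvingSet hn hr (by omega) hW'
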